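/- Let $\mathbb H$ be a complex Hilbert space, let $\mathbb H^{\otimes n}$ be its $n$-fold Hilbert space tensor power, and let $\mathbb H^{(n)}\subset\mathbb H^{\otimes n}$ be the closed subspace of antisymmetric vectors, i.e. of the $\psi$ with $U_\pi\psi=\mathrm{sgn}(\pi)\psi$ for all permutations $\pi$, where $U_\pi(x_1\otimes\cdots\otimes x_n)=x_{\pi^{-1}(1)}\otimes\cdots\otimes x_{\pi^{-1}(n)}$. Let $\mathbb F_{\mathbb H}=\bigoplus_{n\ge0}\mathbb H^{(n)}$ be the fermionic Fock space and $N$ the number operator on it, i.e. the self-adjoint operator that is multiplication by $n$ on $\mathbb H^{(n)}$, with its maximal domain. Let $D$ be a density operator on $\mathbb F_{\mathbb H}$ (a positive operator with $\mathrm{Tr}\,D=1$) that commutes with $N$ and satisfies $\mathrm{Tr}(ND)<\infty$ (i.e. $ND$ is trace class). Write $D=\bigoplus_{n\ge0}D_n$ with $D_n$ acting on $\mathbb H^{(n)}$. For $n\ge1$ let $D_{n:1}$ be the partial trace of $D_n$, i.e. the operator on $\mathbb H$ with $$\langle\xi,D_{n:1}\psi\rangle=\sum_{\phi\in\mathcal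 O}\big\langle\xi\otimes\phi,\ \overline{D_n}(\psi\otimes\phi)\big\rangle\qquad(\xi,\psi\in\mathbb H),$$ where $\mathcal O$ is an orthonormal basis of $\mathbb H^{\otimes(n-1)}$ and $\overline{D_n}$ is the extension of $D_n$ to $\mathbb H^{\otimes n}$ by zero on the orthogonal complement of $\mathbb H^{(n)}$. Let $$\mathcal N_1(D)=\sum_{n=1}^{\infty}n\,D_{n:1}$$ be the one-particle reduced number density operator. Then the sums defining $D_{n:1}$ (as sums over $\mathcal O$ of bounded operators on $\mathbb H$) and $\mathcal N_1(D)$ converge unconditionally in operator norm, and $\|\mathcal N_1(D)\|\le1$. -/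

import Mathlib

open scoped InnerProductSpace ENNReal

namespace FermionFock

noncomputable section

section TensorPower

variable (H : Type*) [NormedAddCommGroup H] [InnerProductSpace ℂ H]

/-- The algebraic `n`-fold tensor power of `H`. A separate name is used because Mathlib puts a
different norm (the projective one) on `PiTensorProduct`. -/
def AlgTensorPower (n : ℕ) : Type _ := PiTensorProduct ℂ (fun _ : Fin n => H)

instance (n : ℕ) : AddCommGroup (AlgTensorPower H n) :=
  inferInstanceAs (AddCommGroup (PiTensorProduct ℂ (fun _ : Fin n => H)))

instance (n : ℕ) : Module ℂ (AlgTensorPower H n) :=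
  inferInstanceAs (Module ℂ (PiTensorProduct ℂ (fun _ : Fin n => H)))

variable {H}

namespace AlgTensorPower

/-- The simple tensor `x₁ ⊗ ⋯ ⊗ xₙ`, as a multilinear map. -/
def tprod (n : ℕ) : MultilinearMap ℂ (fun _ : Fin n => H) (AlgTensorPower H n) :=
  PiTensorProduct.tprod ℂ

/-- The linear map on the tensor power induced by a multilinear map. -/
def lift {n : ℕ} {M : Type*} [AddCommGroup M] [Module ℂ M] :
    MultilinearMap ℂ (fun _ : Fin n => H) M →ₗ[ℂ] AlgTensorPower H n →ₗ[ℂ] M :=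
  (PiTensorProduct.lift (R := ℂ) (s := fun _ : Fin n => H) (E := M)).toLinearMap

theorem lift_tprod {n : ℕ} {M : Type*} [AddCommGroup M] [Module ℂ M]
    (f : MultilinearMap ℂ (fun _ : Fin n => H) M) (x : Fin n → H) :
    lift f (tprod n x) = f x :=
  PiTensorProduct.lift.tprod x

theorem smul_tprod_induction {n : ℕ} {C : AlgTensorPower H n → Prop} (x : AlgTensorPower H n)
    (hs : ∀ (c : ℂ) (a : Fin n → H), C (c • tprod n a)) (ha : ∀ x y, C x → C y → C (x + y)) :
    C x :=
  PiTensorProduct.induction_on (motive := C) x hs ha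

theorem exists_sum {n : ℕ} (x : AlgTensorPower H n) :
    ∃ (m : ℕ) (c : Fin m → ℂ) (a : Fin m → Fin n → H), x = ∑ i, c i • tprod n (a i) := by
  induction x using smul_tprod_induction with
  | hs c a => exact ⟨1, fun _ => c, fun _ => a, by simp⟩
  | ha x y hx hy =>
    obtain ⟨m, c, a, rfl⟩ := hx
    obtain ⟨m', c', a', rfl⟩ := hy
    refine ⟨m + m', Fin.append c c', Fin.append a a', ?_⟩
    simp [Fin.sum_univ_add]

/-- `y₁ ⊗ ⋯ ⊗ yₙ ↦ ⟨a₁, y₁⟩ ⋯ ⟨aₙ, yₙ⟩`, extended linearly. -/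
def pairing {n : ℕ} (a : Fin n → H) : AlgTensorPower H n →ₗ[ℂ] ℂ :=
  lift ((MultilinearMap.mkPiAlgebra ℂ (Fin n) ℂ).compLinearMap
    fun k => (innerSL ℂ (a k)).toLinearMap)

theorem pairing_tprod {n : ℕ} (a y : Fin n → H) :
    pairing a (tprod n y) = ∏ k, ⟪a k, y k⟫_ℂ := by
  simp [pairing, lift_tprod]

theorem conj_pairing {n : ℕ} (a y : Fin n → H) :
    starRingEnd ℂ (pairing a (tprod n y)) = pairing y (tprod n a) := by
  simp [pairing_tprod, map_prod]

/-- For fixed `y`, the map `a₁ ⊗ ⋯ ⊗ aₙ ↦ conj ⟨a₁ ⊗ ⋯ ⊗ aₙ, y⟩`, as a multilinear map. -/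
def conjPairing {n : ℕ} (y : AlgTensorPower H n) : MultilinearMap ℂ (fun _ : Fin n => H) ℂ where
  toFun a := starRingEnd ℂ (pairing a y)
  map_update_add' m i u v := by
    induction y using smul_tprod_induction with
    | hs c b =>
      have h := (pairing b ∘ₗ LinearMap.id).compMultilinearMap (tprod n) |>.map_update_add m i u v
      simp only [LinearMap.compMultilinearMap_apply, LinearMap.comp_id] at h
      simp only [map_smul, smul_eq_mul, map_mul, conj_pairing]
      convert congrArg (fun z => starRingEnd ℂ c * z) h using 1
      ring
    | ha x y hx hy => simp only [map_add, hx, hy]; ring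
  map_update_smul' m i r u := by
    induction y using smul_tprod_induction with
    | hs c b =>
      have h := (pairing b ∘ₗ LinearMap.id).compMultilinearMap (tprod n) |>.map_update_smul m i r u
      simp only [LinearMap.compMultilinearMap_apply, LinearMap.comp_id] at h
      simp only [map_smul, smul_eq_mul, map_mul, conj_pairing]
      convert congrArg (fun z => starRingEnd ℂ c * z) h using 1
      simp only [smul_eq_mul]; ring
    | ha x y hx hy => simp only [map_add, hx, hy, smul_add]

/-- The inner product, conjugate linear in the first variable, with
`⟨x₁ ⊗ ⋯ ⊗ xₙ, y₁ ⊗ ⋯ ⊗ yₙ⟩ = ⟨x₁, y₁⟩ ⋯ ⟨xₙ, yₙ⟩`. -/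
def innerForm {n : ℕ} (x y : AlgTensorPower H n) : ℂ := starRingEnd ℂ (lift (conjPairing y) x)

theorem innerForm_tprod_left {n : ℕ} (a : Fin n → H) (y : AlgTensorPower H n) :
    innerForm (tprod n a) y = pairing a y := by
  simp [innerForm, lift_tprod, conjPairing]

theorem innerForm_tprod {n : ℕ} (a b : Fin n → H) :
    innerForm (tprod n a) (tprod n b) = ∏ k, ⟪a k, b k⟫_ℂ := by
  rw [innerForm_tprod_left, pairing_tprod]

theorem innerForm_add_left {n : ℕ} (x y z : AlgTensorPower H n) :
    innerForm (x + y) z = innerForm x z + innerForm y z := by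
  simp [innerForm]

theorem innerForm_smul_left {n : ℕ} (r : ℂ) (x y : AlgTensorPower H n) :
    innerForm (r • x) y = starRingEnd ℂ r * innerForm x y := by
  simp [innerForm]

theorem innerForm_add_right {n : ℕ} (x y z : AlgTensorPower H n) :
    innerForm x (y + z) = innerForm x y + innerForm x z := by
  induction x using smul_tprod_induction with
  | hs c a => simp [innerForm_smul_left, innerForm_tprod_left, mul_add]
  | ha u v hu hv => simp only [innerForm_add_left, hu, hv]; ring

theorem innerForm_smul_right {n : ℕ} (r : ℂ) (x y : AlgTensorPower H n) :
    innerForm x (r • y) = r * innerForm x y := by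
  induction x using smul_tprod_induction with
  | hs c a => simp [innerForm_smul_left, innerForm_tprod_left]; ring
  | ha u v hu hv => simp only [innerForm_add_left, hu, hv]; ring

theorem innerForm_conj_symm {n : ℕ} (x y : AlgTensorPower H n) :
    starRingEnd ℂ (innerForm y x) = innerForm x y := by
  induction x using smul_tprod_induction with
  | hs c a =>
    induction y using smul_tprod_induction with
    | hs d b =>
      simp [innerForm_smul_left, innerForm_smul_right, innerForm_tprod_left, conj_pairing]; ring
    | ha u v hu hv => simp only [innerForm_add_left, innerForm_add_right, map_add, hu, hv]
  | ha u v hu hv => simp only [innerForm_add_left, innerForm_add_right, map_add, hu, hv]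

open scoped ComplexOrder in
theorem posSemidef_prod {ι : Type*} [Finite ι] {n : ℕ} (a : ι → Fin n → H) (s : Finset (Fin n)) :
    (Matrix.of fun i j => ∏ k ∈ s, ⟪a i k, a j k⟫_ℂ).PosSemidef := by
  classical
  induction s using Finset.induction_on with
  | empty =>
    have := Matrix.posSemidef_gram (𝕜 := ℂ) (fun _ : ι => (1 : ℂ))
    have e : (Matrix.of fun i j : ι => ∏ k ∈ (∅ : Finset (Fin n)), ⟪a i k, a j k⟫_ℂ) =
        Matrix.gram ℂ (fun _ : ι => (1 : ℂ)) := by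
      ext i j
      simp [Matrix.gram]
    rw [e]; exact this
  | insert k s hk ih =>
    have := (Matrix.posSemidef_gram (𝕜 := ℂ) (fun i => a i k)).hadamard ih
    have e : (Matrix.of fun i j : ι => ∏ k ∈ insert k s, ⟪a i k, a j k⟫_ℂ) =
        Matrix.hadamard (Matrix.gram ℂ (fun i => a i k))
          (Matrix.of fun i j => ∏ k ∈ s, ⟪a i k, a j k⟫_ℂ) := by
      ext i j
      simp [Matrix.gram, Finset.prod_insert hk]
    rw [e]; exact this

theorem innerForm_sum_sum {n m : ℕ} (c : Fin m → ℂ) (a : Fin m → Fin n → H) :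
    innerForm (∑ i, c i • tprod n (a i)) (∑ i, c i • tprod n (a i)) =
      ∑ i, ∑ j, starRingEnd ℂ (c i) * (c j * ∏ k, ⟪a i k, a j k⟫_ℂ) := by
  have h1 : ∀ y : AlgTensorPower H n, innerForm (∑ i, c i • tprod n (a i)) y =
      ∑ i, starRingEnd ℂ (c i) * pairing (a i) y := by
    intro y
    simp [innerForm, lift_tprod, conjPairing]
  rw [h1]
  simp [Finset.mul_sum, pairing_tprod]

theorem innerForm_self_nonneg {n : ℕ} (x : AlgTensorPower H n) : 0 ≤ (innerForm x x).re := by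
  obtain ⟨m, c, a, rfl⟩ := exists_sum x
  open scoped ComplexOrder in
  have h := (Complex.le_def.1 ((posSemidef_prod a Finset.univ).dotProduct_mulVec_nonneg c)).1
  rw [Complex.zero_re] at h
  refine h.trans_eq (congrArg Complex.re ?_)
  rw [innerForm_sum_sum]
  simp only [dotProduct, Matrix.mulVec, Matrix.of_apply, Pi.star_apply, Finset.mul_sum]
  refine Finset.sum_congr rfl fun i _ => Finset.sum_congr rfl fun j _ => ?_
  rw [starRingEnd_apply]
  ring

/-- The inner product on the algebraic tensor power. -/
@[reducible] def core (n : ℕ) : PreInnerProductSpace.Core ℂ (AlgTensorPower H n) where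
  inner := innerForm
  conj_inner_symm := innerForm_conj_symm
  re_inner_nonneg := innerForm_self_nonneg
  add_left := innerForm_add_left
  smul_left x y r := innerForm_smul_left r x y

instance (n : ℕ) : SeminormedAddCommGroup (AlgTensorPower H n) :=
  @InnerProductSpace.Core.toSeminormedAddCommGroup ℂ (AlgTensorPower H n) _ _ _ (core n)

instance (n : ℕ) : InnerProductSpace ℂ (AlgTensorPower H n) :=
  InnerProductSpace.ofCore (core n)

theorem inner_tprod {n : ℕ} (x y : Fin n → H) :
    ⟪tprod n x, tprod n y⟫_ℂ = ∏ k, ⟪x k, y k⟫_ℂ :=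
  innerForm_tprod x y

/-- The linear map `x₁ ⊗ ⋯ ⊗ xₙ ↦ x_{π⁻¹(1)} ⊗ ⋯ ⊗ x_{π⁻¹(n)}`. -/
def perm {n : ℕ} (π : Equiv.Perm (Fin n)) : AlgTensorPower H n →ₗ[ℂ] AlgTensorPower H n :=
  lift ((tprod n).domDomCongr π.symm)

theorem perm_tprod {n : ℕ} (π : Equiv.Perm (Fin n)) (x : Fin n → H) :
    perm π (tprod n x) = tprod n (fun k => x (π⁻¹ k)) := by
  rw [perm, lift_tprod]; rfl

theorem inner_perm {n : ℕ} (π : Equiv.Perm (Fin n)) (x y : AlgTensorPower H n) :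
    ⟪perm π x, perm π y⟫_ℂ = ⟪x, y⟫_ℂ := by
  induction x using smul_tprod_induction with
  | hs c a =>
    induction y using smul_tprod_induction with
    | hs d b =>
      simp only [map_smul, inner_smul_left, inner_smul_right, perm_tprod, inner_tprod]
      rw [Equiv.prod_comp π⁻¹ (fun k => ⟪a k, b k⟫_ℂ)]
    | ha u v hu hv => simp only [map_add, inner_add_right, hu, hv]
  | ha u v hu hv => simp only [map_add, inner_add_left, hu, hv]

/-- `perm π` as an isometry. -/
def permIsometry {n : ℕ} (π : Equiv.Perm (Fin n)) :
    AlgTensorPower H n →ₗᵢ[ℂ] AlgTensorPower H n where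
  toLinearMap := perm π
  norm_map' x := by
    rw [@norm_eq_sqrt_re_inner ℂ, @norm_eq_sqrt_re_inner ℂ, inner_perm]

/-- `(x₀, x₁ ⊗ ⋯ ⊗ xₙ) ↦ x₀ ⊗ x₁ ⊗ ⋯ ⊗ xₙ`, extended bilinearly. -/
def cons (n : ℕ) : H →ₗ[ℂ] AlgTensorPower H n →ₗ[ℂ] AlgTensorPower H (n + 1) :=
  lift ∘ₗ (tprod (n + 1)).curryLeft

theorem cons_tprod {n : ℕ} (ψ : H) (x : Fin n → H) :
    cons n ψ (tprod n x) = tprod (n + 1) (Fin.cons ψ x) := by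
  simp [cons, lift_tprod]

theorem inner_cons {n : ℕ} (ξ ψ : H) (x y : AlgTensorPower H n) :
    ⟪cons n ξ x, cons n ψ y⟫_ℂ = ⟪ξ, ψ⟫_ℂ * ⟪x, y⟫_ℂ := by
  induction x using smul_tprod_induction with
  | hs c a =>
    induction y using smul_tprod_induction with
    | hs d b =>
      simp only [map_smul, inner_smul_left, inner_smul_right, cons_tprod, inner_tprod,
        Fin.prod_univ_succ, Fin.cons_zero, Fin.cons_succ]
      ring
    | ha u v hu hv => simp only [map_add, inner_add_right, hu, hv]; ring
  | ha u v hu hv => simp only [map_add, inner_add_left, hu, hv]; ring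

theorem norm_cons {n : ℕ} (ψ : H) (x : AlgTensorPower H n) : ‖cons n ψ x‖ = ‖ψ‖ * ‖x‖ := by
  have h : ‖cons n ψ x‖ ^ 2 = (‖ψ‖ * ‖x‖) ^ 2 := by
    rw [mul_pow, ← inner_self_eq_norm_sq (𝕜 := ℂ), ← inner_self_eq_norm_sq (𝕜 := ℂ),
      ← inner_self_eq_norm_sq (𝕜 := ℂ), inner_cons]
    have h1 := inner_self_im (𝕜 := ℂ) ψ
    simp only [RCLike.re_to_complex, RCLike.im_to_complex] at h1 ⊢
    rw [Complex.mul_re, h1]; ring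
  exact (pow_left_inj₀ (norm_nonneg _) (by positivity) two_ne_zero).1 h

/-- `cons` as a bounded bilinear map. -/
def consL (n : ℕ) : H →L[ℂ] AlgTensorPower H n →L[ℂ] AlgTensorPower H (n + 1) :=
  (cons n).mkContinuous₂ 1 fun ψ x => by rw [norm_cons, one_mul]

end AlgTensorPower

variable (H) in
/-- The Hilbert space tensor power `H^{⊗n}`: the completion of the algebraic tensor power with
respect to `⟨y₁ ⊗ ⋯ ⊗ yₙ, x₁ ⊗ ⋯ ⊗ xₙ⟩ = ⟨y₁, x₁⟩ ⋯ ⟨yₙ, xₙ⟩`. -/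
abbrev TensorPower (n : ℕ) : Type _ := UniformSpace.Completion (AlgTensorPower H n)

/-- The simple tensor `x₁ ⊗ ⋯ ⊗ xₙ` in `H^{⊗n}`. -/
def simpleTensor {n : ℕ} (x : Fin n → H) : TensorPower H n :=
  ((AlgTensorPower.tprod n x : AlgTensorPower H n) : TensorPower H n)

theorem inner_simpleTensor {n : ℕ} (y x : Fin n → H) :
    ⟪simpleTensor y, simpleTensor x⟫_ℂ = ∏ k, ⟪y k, x k⟫_ℂ := by
  rw [simpleTensor, simpleTensor, UniformSpace.Completion.inner_coe, AlgTensorPower.inner_tprod]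

/-- The operator `U_π` on `H^{⊗n}`. -/
def permOp {n : ℕ} (π : Equiv.Perm (Fin n)) : TensorPower H n →L[ℂ] TensorPower H n :=
  (AlgTensorPower.permIsometry π).toContinuousLinearMap.completion

theorem permOp_simpleTensor {n : ℕ} (π : Equiv.Perm (Fin n)) (x : Fin n → H) :
    permOp π (simpleTensor x) = simpleTensor fun k => x (π⁻¹ k) := by
  rw [permOp, simpleTensor, ContinuousLinearMap.completion_apply_coe]
  exact congrArg _ (AlgTensorPower.perm_tprod π x)

theorem norm_completion_consL_le {n : ℕ} (ψ : H) (φ : TensorPower H n) :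
    ‖(AlgTensorPower.consL n ψ).completion φ‖ ≤ 1 * ‖ψ‖ * ‖φ‖ := by
  induction φ using UniformSpace.Completion.induction_on with
  | hp => exact isClosed_le (by fun_prop) (by fun_prop)
  | ih x =>
    rw [ContinuousLinearMap.completion_apply_coe, UniformSpace.Completion.norm_coe,
      UniformSpace.Completion.norm_coe, one_mul]
    exact (AlgTensorPower.norm_cons ψ x).le

theorem completion_consL_smul {n : ℕ} (c : ℂ) (ψ : H) (φ : TensorPower H n) :
    (AlgTensorPower.consL n (c • ψ)).completion φ =
      c • (AlgTensorPower.consL n ψ).completion φ := by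
  induction φ using UniformSpace.Completion.induction_on with
  | hp =>
    exact isClosed_eq (ContinuousLinearMap.continuous _)
      ((ContinuousLinearMap.continuous _).const_smul c)
  | ih x =>
    rw [ContinuousLinearMap.completion_apply_coe, ContinuousLinearMap.completion_apply_coe,
      ← UniformSpace.Completion.coe_smul]
    congr 1
    exact LinearMap.map_smul₂ (AlgTensorPower.cons n) c ψ x

/-- The bounded bilinear map `(ψ, φ) ↦ ψ ⊗ φ` from `H × H^{⊗n}` to `H^{⊗(n+1)}`. -/
def tensorCons (n : ℕ) : H →L[ℂ] TensorPower H n →L[ℂ] TensorPower H (n + 1) :=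
  (LinearMap.mk₂ ℂ (fun (ψ : H) (φ : TensorPower H n) =>
      (AlgTensorPower.consL n ψ).completion φ)
    (fun ψ ψ' φ => by
      induction φ using UniformSpace.Completion.induction_on with
      | hp => exact isClosed_eq (by fun_prop) (by fun_prop)
      | ih x =>
        simp only [ContinuousLinearMap.completion_apply_coe, map_add,
          add_apply, UniformSpace.Completion.coe_add])
    completion_consL_smul
    (fun ψ φ φ' => map_add _ _ _)
    (fun c ψ φ => map_smul _ _ _)).mkContinuous₂ 1 norm_completion_consL_le

theorem tensorCons_simpleTensor {n : ℕ} (ψ : H) (x : Fin n → H) :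
    tensorCons n ψ (simpleTensor x) = simpleTensor (Fin.cons ψ x) := by
  change (AlgTensorPower.consL n ψ).completion (simpleTensor x) = _
  rw [simpleTensor, ContinuousLinearMap.completion_apply_coe]
  exact congrArg _ (AlgTensorPower.cons_tprod ψ x)

variable (H) in
/-- The antisymmetric subspace `H^{(n)}` of `H^{⊗n}`. -/
def antisymmetric (n : ℕ) : Submodule ℂ (TensorPower H n) where
  carrier := {ψ | ∀ π : Equiv.Perm (Fin n), permOp π ψ = ((Equiv.Perm.sign π : ℤ) : ℂ) • ψ}
  add_mem' := fun ha hb π => by rw [map_add, ha π, hb π, smul_add]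
  zero_mem' := fun π => by simp
  smul_mem' := fun c x hx π => by rw [map_smul, hx π, smul_comm]

theorem isClosed_antisymmetric (n : ℕ) :
    IsClosed (antisymmetric H n : Set (TensorPower H n)) := by
  have : (antisymmetric H n : Set (TensorPower H n)) =
      ⋂ π : Equiv.Perm (Fin n), {ψ | permOp π ψ = ((Equiv.Perm.sign π : ℤ) : ℂ) • ψ} := by
    ext ψ; simp [antisymmetric]
  rw [this]
  exact isClosed_iInter fun π => isClosed_eq (by fun_prop) (by fun_prop)

instance (n : ℕ) : CompleteSpace (antisymmetric H n) :=
  (isClosed_antisymmetric n).completeSpace_coe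

variable (H) in
/-- The fermion Fock space: the Hilbert space direct sum of the spaces `H^{(n)}`, `n ≥ 0`. -/
abbrev FockSpace : Type _ := lp (fun n : ℕ => antisymmetric H n) 2

variable (H) in
/-- The number operator on Fock space: multiplication by `n` on `H^{(n)}`, with its maximal domain,
the vectors `ψ` such that `(n ψ_n)_n` is square summable. -/
def numberOp : FockSpace H →ₗ.[ℂ] FockSpace H where
  domain :=
    { carrier := {ψ | Memℓp (fun n : ℕ => (n : ℂ) • ψ n) 2}
      add_mem' := fun {a b} ha hb => by
        have h := Memℓp.add ha hb
        have e : (fun n : ℕ => (n : ℂ) • (a + b) n) =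
            (fun n : ℕ => (n : ℂ) • a n) + fun n : ℕ => (n : ℂ) • b n := by
          funext n; simp
        change Memℓp (fun n : ℕ => (n : ℂ) • (a + b) n) 2
        rw [e]; exact h
      zero_mem' := by
        have e : (fun n : ℕ => (n : ℂ) • (0 : FockSpace H) n) = 0 := by funext n; simp
        change Memℓp (fun n : ℕ => (n : ℂ) • (0 : FockSpace H) n) 2
        rw [e]; exact zero_memℓp
      smul_mem' := fun c a ha => by
        have h := Memℓp.const_smul ha c
        have e : (fun n : ℕ => (n : ℂ) • (c • a) n) = c • fun n : ℕ => (n : ℂ) • a n := by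
          funext n; simp [smul_comm c]
        change Memℓp (fun n : ℕ => (n : ℂ) • (c • a) n) 2
        rw [e]; exact h }
  toFun :=
    { toFun := fun ψ => ⟨fun n : ℕ => (n : ℂ) • (ψ : FockSpace H) n, ψ.2⟩
      map_add' := fun a b => by ext n : 2; simp; rfl
      map_smul' := fun c a => by ext n : 2; simp [smul_comm c] }

end TensorPower

section Trace

variable {K : Type*} [NormedAddCommGroup K] [InnerProductSpace ℂ K] [CompleteSpace K]

variable (K) in
/-- An orthonormal basis of the Hilbert space `K`. -/
def stdBasis : HilbertBasis (exists_hilbertBasis ℂ K).choose ℂ K :=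
  (exists_hilbertBasis ℂ K).choose_spec.choose

/-- The trace, in `[0, ∞]`, of a positive bounded operator: the sum of `⟨e, T e⟩` over an
orthonormal basis (the value does not depend on the basis). -/
def posTrace (T : K →L[ℂ] K) : ℝ≥0∞ :=
  ∑' i, ENNReal.ofReal (⟪stdBasis K i, T (stdBasis K i)⟫_ℂ).re

/-- A bounded operator is trace class if `Tr |T| < ∞`. -/
def IsTraceClass (T : K →L[ℂ] K) : Prop := posTrace (CFC.abs T) < ∞

/-- A density operator: a positive operator of unit trace. -/
def IsDensityOperator (D : K →L[ℂ] K) : Prop := D.IsPositive ∧ posTrace D = 1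

end Trace

section Reduced

variable {H : Type*} [NormedAddCommGroup H] [InnerProductSpace ℂ H]

/-- `A` commutes with the number operator `N`: `A` maps the domain of `N` to itself, and
`N A ψ = A N ψ` for all `ψ` in this domain. -/
def CommutesWithNumber (A : FockSpace H →L[ℂ] FockSpace H) : Prop :=
  ∀ ψ : (numberOp H).domain, ∃ h : A ψ ∈ (numberOp H).domain,
    numberOp H ⟨A ψ, h⟩ = A (numberOp H ψ)

/-- `Tr (N D) < ∞`: the operator `N D` is everywhere defined, bounded and trace class. -/
def FiniteExpectedNumber (D : FockSpace H →L[ℂ] FockSpace H) : Prop :=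
  ∃ B : FockSpace H →L[ℂ] FockSpace H, IsTraceClass B ∧
    ∀ ψ, ∃ h : D ψ ∈ (numberOp H).domain, numberOp H ⟨D ψ, h⟩ = B ψ

/-- The inclusion of `H^{(n)}` in Fock space. -/
def sectorIncl (n : ℕ) : antisymmetric H n →L[ℂ] FockSpace H :=
  lp.singleContinuousLinearMap ℂ (fun n : ℕ => antisymmetric H n) 2 n

/-- The diagonal block `D_n` of `D` on `H^{(n)}`. If `D` commutes with the number operator, then
`D` is the direct sum of the operators `D_n`. -/
def sector (D : FockSpace H →L[ℂ] FockSpace H) (n : ℕ) :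
    antisymmetric H n →L[ℂ] antisymmetric H n :=
  (sectorIncl n).adjoint ∘L D ∘L sectorIncl n

/-- The extension of an operator on `H^{(n)}` to `H^{⊗n}` by zero on the orthogonal complement. -/
def extend {n : ℕ} (T : antisymmetric H n →L[ℂ] antisymmetric H n) :
    TensorPower H n →L[ℂ] TensorPower H n :=
  (antisymmetric H n).subtypeL ∘L T ∘L (antisymmetric H n).orthogonalProjectionOnto

variable [CompleteSpace H]

/-- The summand of the partial trace belonging to `φ ∈ H^{⊗n}`: the operator `S` on `H` with
`⟨ξ, S ψ⟩ = ⟨ξ ⊗ φ, T (ψ ⊗ φ)⟩`, where `T` on `H^{(n+1)}` is extended by zero to `H^{⊗(n+1)}`. -/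
def partialTraceTerm {n : ℕ} (T : antisymmetric H (n + 1) →L[ℂ] antisymmetric H (n + 1))
    (φ : TensorPower H n) : H →L[ℂ] H :=
  ((tensorCons n).flip φ).adjoint ∘L extend T ∘L (tensorCons n).flip φ

theorem inner_partialTraceTerm {n : ℕ}
    (T : antisymmetric H (n + 1) →L[ℂ] antisymmetric H (n + 1)) (φ : TensorPower H n) (ξ ψ : H) :
    ⟪ξ, partialTraceTerm T φ ψ⟫_ℂ = ⟪tensorCons n ξ φ, extend T (tensorCons n ψ φ)⟫_ℂ := by
  simp [partialTraceTerm, ContinuousLinearMap.adjoint_inner_right]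

/-- The partial trace `T_{:1}` of an operator `T` on `H^{(n+1)}`:
`⟨ξ, T_{:1} ψ⟩ = ∑_φ ⟨ξ ⊗ φ, T (ψ ⊗ φ)⟩`, summed over an orthonormal basis of `H^{⊗n}` (for trace
class `T` the value does not depend on the basis). -/
def partialTrace {n : ℕ} (T : antisymmetric H (n + 1) →L[ℂ] antisymmetric H (n + 1)) :
    H →L[ℂ] H :=
  ∑' i, partialTraceTerm T (stdBasis (TensorPower H n) i)

/-- The one-particle reduced number density operator
`N₁(D) = ∑_{n ≥ 1} n D_{n:1} = ∑_{n ≥ 0} (n + 1) D_{n+1:1}`. -/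
def reducedNumberDensity (D : FockSpace H →L[ℂ] FockSpace H) : H →L[ℂ] H :=
  ∑' n : ℕ, ((n : ℂ) + 1) • partialTrace (sector D (n + 1))

end Reduced

end

end FermionFock

namespace FermionFock

/-! ### Trace inequalities for positive operators -/

section TraceInequality

variable {K L : Type*} [NormedAddCommGroup K] [InnerProductSpace ℂ K] [CompleteSpace K]
  [NormedAddCommGroup L] [InnerProductSpace ℂ L] [CompleteSpace L]

/-! The bound is the Pauli principle: a fermionic one-particle state has occupation at most 1. For a
unit vector `ψ`, let `A` be the map `φ ↦ P (ψ ⊗ φ)`, with `P` the projection onto the antisymmetric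
subspace of the `n`-fold tensor power. Then `⟨ψ, D_{n:1} ψ⟩` is the trace of `A* D_n A`. On
antisymmetric tensors `‖A* χ‖² ≤ ‖χ‖² / n` (`norm_sq_adjoint_tensorCons_le`), and compressing a
positive operator by `A` costs at most that factor in trace (`tsum_inner_conj_le_posTrace`). Hence
`n ‖D_{n:1}‖ ≤ Tr D_n` (`norm_partialTrace_le`).

The blocks satisfy `∑ Tr D_n ≤ Tr D = 1` (`tsum_posTrace_sector_le`), which gives both absolute
convergence of the number density series and the norm bound. The partial trace sums converge
absolutely as well, because the norms of their terms add up to at most `Tr D_n`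
(`tsum_norm_partialTraceTerm_le`). -/

theorem exists_sqrt {T : K →L[ℂ] K} (hT : T.IsPositive) :
    ∃ S : K →L[ℂ] K, S.adjoint = S ∧ S ∘L S = T ∧ ∀ x, (⟪x, T x⟫_ℂ).re = ‖S x‖ ^ 2 := by
  have h0 : 0 ≤ T := (ContinuousLinearMap.nonneg_iff_isPositive T).2 hT
  have hS := (ContinuousLinearMap.nonneg_iff_isPositive _).1 (CFC.sqrt_nonneg T)
  have hadj : (CFC.sqrt T).adjoint = CFC.sqrt T := hS.isSelfAdjoint
  refine ⟨CFC.sqrt T, hadj, CFC.sqrt_mul_sqrt_self T h0, fun x => ?_⟩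
  have h : T x = CFC.sqrt T (CFC.sqrt T x) := by
    conv_lhs => rw [← CFC.sqrt_mul_sqrt_self T h0]
    rfl
  rw [h, ← ContinuousLinearMap.adjoint_inner_left, hadj, inner_self_eq_norm_sq_to_K]
  norm_cast

omit [CompleteSpace K] in
theorem tsum_ofReal_norm_inner_sq_le {ι : Type*} {v : ι → K} (hv : Orthonormal ℂ v) (x : K) :
    ∑' i, ENNReal.ofReal (‖⟪v i, x⟫_ℂ‖ ^ 2) ≤ ENNReal.ofReal (‖x‖ ^ 2) := by
  rw [← ENNReal.ofReal_tsum_of_nonneg (fun i => by positivity) (hv.inner_products_summable x)]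
  exact ENNReal.ofReal_le_ofReal (hv.tsum_inner_products_le x)

omit [CompleteSpace K] in
-- Parseval with values in `[0, ∞]`, so that double sums can be interchanged without summability
-- conditions.
theorem _root_.HilbertBasis.tsum_ofReal_norm_inner_sq {ι : Type*} (b : HilbertBasis ι ℂ K)
    (x : K) : ∑' i, ENNReal.ofReal (‖⟪b i, x⟫_ℂ‖ ^ 2) = ENNReal.ofReal (‖x‖ ^ 2) := by
  rw [← ENNReal.ofReal_tsum_of_nonneg (fun i => by positivity)
    (b.orthonormal.inner_products_summable x)]
  congr 1
  have h := (b.hasSum_inner_mul_inner x x).mapL Complex.reCLM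
  rw [← inner_self_eq_norm_sq (𝕜 := ℂ) x]
  refine (HasSum.tsum_eq ?_)
  convert h using 2 with i
  · rw [← inner_conj_symm x (b i), ← Complex.normSq_eq_conj_mul_self, Complex.normSq_eq_norm_sq]
    exact (Complex.ofReal_re _).symm
  · rfl

/-- Compression of a positive operator by `A` multiplies its trace by at most `‖A‖²`; stated for an
arbitrary orthonormal family. -/
theorem tsum_inner_conj_le_posTrace {T : K →L[ℂ] K} (hT : T.IsPositive) (A : L →L[ℂ] K) {c : ℝ}
    (hA : ∀ x, ‖A.adjoint x‖ ^ 2 ≤ c * ‖x‖ ^ 2) {ι : Type*} {v : ι → L}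
    (hv : Orthonormal ℂ v) :
    ∑' j, ENNReal.ofReal (⟪A (v j), T (A (v j))⟫_ℂ).re ≤ ENNReal.ofReal c * posTrace T := by
  obtain ⟨S, hS, -, hST⟩ := exists_sqrt hT
  have key : ∀ i j, ⟪stdBasis K i, S (A (v j))⟫_ℂ = ⟪A.adjoint (S (stdBasis K i)), v j⟫_ℂ := by
    intro i j
    rw [ContinuousLinearMap.adjoint_inner_left, ← ContinuousLinearMap.adjoint_inner_left S, hS]
  calc ∑' j, ENNReal.ofReal (⟪A (v j), T (A (v j))⟫_ℂ).re
      = ∑' j, ∑' i, ENNReal.ofReal (‖⟪stdBasis K i, S (A (v j))⟫_ℂ‖ ^ 2) := by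
        -- With `T = S²`, each term is `‖S A v_j‖²`, expanded by Parseval. After the interchange of
        -- sums, Bessel for `v` bounds the inner sum by `‖A* S e_i‖² ≤ c ‖S e_i‖²`.
        simp_rw [hST, (stdBasis K).tsum_ofReal_norm_inner_sq]
    _ = ∑' i, ∑' j, ENNReal.ofReal (‖⟪v j, A.adjoint (S (stdBasis K i))⟫_ℂ‖ ^ 2) := by
        rw [ENNReal.tsum_comm]
        simp_rw [key, norm_inner_symm]
    _ ≤ ∑' i, ENNReal.ofReal c * ENNReal.ofReal (⟪stdBasis K i, T (stdBasis K i)⟫_ℂ).re := by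
        refine ENNReal.tsum_le_tsum fun i => (tsum_ofReal_norm_inner_sq_le hv _).trans ?_
        rw [hST, ← ENNReal.ofReal_mul' (by positivity)]
        exact ENNReal.ofReal_le_ofReal (hA _)
    _ = ENNReal.ofReal c * posTrace T := by rw [ENNReal.tsum_mul_left]; rfl

theorem norm_sq_adjoint_le {A : L →L[ℂ] K} (hA : ∀ x, ‖A x‖ ≤ ‖x‖) (x : K) :
    ‖A.adjoint x‖ ^ 2 ≤ 1 * ‖x‖ ^ 2 := by
  have h : ‖A.adjoint‖ ≤ 1 := by
    rw [LinearIsometryEquiv.norm_map]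
    exact A.opNorm_le_bound zero_le_one (by simpa using hA)
  rw [one_mul]
  gcongr
  simpa using A.adjoint.le_of_opNorm_le h x

theorem tsum_inner_le_posTrace {T : K →L[ℂ] K} (hT : T.IsPositive) {ι : Type*} {v : ι → K}
    (hv : Orthonormal ℂ v) :
    ∑' j, ENNReal.ofReal (⟪v j, T (v j)⟫_ℂ).re ≤ posTrace T := by
  simpa using tsum_inner_conj_le_posTrace hT (.id ℂ K) (norm_sq_adjoint_le fun x => le_rfl) hv

end TraceInequality

/-! ### Permutations, the first tensor factor, and the Pauli principle -/

section TensorPower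

variable {H : Type*} [NormedAddCommGroup H] [InnerProductSpace ℂ H]

theorem inner_tensorCons {n : ℕ} (ξ ψ : H) (φ χ : TensorPower H n) :
    ⟪tensorCons n ξ φ, tensorCons n ψ χ⟫_ℂ = ⟪ξ, ψ⟫_ℂ * ⟪φ, χ⟫_ℂ := by
  induction φ, χ using UniformSpace.Completion.induction_on₂ with
  | hp => exact isClosed_eq (by fun_prop) (by fun_prop)
  | ih x y =>
    change ⟪(AlgTensorPower.consL n ξ).completion x, (AlgTensorPower.consL n ψ).completion y⟫_ℂ = _
    rw [ContinuousLinearMap.completion_apply_coe, ContinuousLinearMap.completion_apply_coe,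
      UniformSpace.Completion.inner_coe, UniformSpace.Completion.inner_coe]
    exact AlgTensorPower.inner_cons ξ ψ x y

theorem norm_tensorCons {n : ℕ} (ψ : H) (φ : TensorPower H n) :
    ‖tensorCons n ψ φ‖ = ‖ψ‖ * ‖φ‖ := by
  rw [← pow_left_inj₀ (norm_nonneg _) (by positivity) two_ne_zero, mul_pow]
  have h := inner_tensorCons ψ ψ φ φ
  simp only [inner_self_eq_norm_sq_to_K] at h
  exact_mod_cast h

theorem ext_simpleTensor {n : ℕ} {F : Type*} [NormedAddCommGroup F] [NormedSpace ℂ F]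
    {f g : TensorPower H n →L[ℂ] F} (h : ∀ x : Fin n → H, f (simpleTensor x) = g (simpleTensor x)) :
    f = g := by
  ext φ
  induction φ using UniformSpace.Completion.induction_on with
  | hp => exact isClosed_eq f.continuous g.continuous
  | ih x =>
    induction x using AlgTensorPower.smul_tprod_induction with
    | hs c a =>
      rw [UniformSpace.Completion.coe_smul, map_smul, map_smul]
      exact congrArg _ (h a)
    | ha x y hx hy => rw [UniformSpace.Completion.coe_add, map_add, map_add, hx, hy]

theorem norm_permOp {n : ℕ} (π : Equiv.Perm (Fin n)) (φ : TensorPower H n) :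
    ‖permOp π φ‖ = ‖φ‖ := by
  induction φ using UniformSpace.Completion.induction_on with
  | hp => exact isClosed_eq (by fun_prop) (by fun_prop)
  | ih x =>
    rw [permOp, ContinuousLinearMap.completion_apply_coe, UniformSpace.Completion.norm_coe,
      UniformSpace.Completion.norm_coe]
    exact (AlgTensorPower.permIsometry π).norm_map x

theorem permOp_comp {n : ℕ} (π σ : Equiv.Perm (Fin n)) :
    (permOp π : TensorPower H n →L[ℂ] _) ∘L permOp σ = permOp (π * σ) := by
  refine ext_simpleTensor fun x => ?_
  simp [permOp_simpleTensor]

theorem permOp_one {n : ℕ} : (permOp 1 : TensorPower H n →L[ℂ] _) = .id ℂ _ :=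
  ext_simpleTensor fun x => by simp [permOp_simpleTensor]

theorem inner_permOp {n : ℕ} (π : Equiv.Perm (Fin n)) (φ χ : TensorPower H n) :
    ⟪permOp π φ, permOp π χ⟫_ℂ = ⟪φ, χ⟫_ℂ :=
  LinearIsometry.inner_map_map ⟨(permOp π).toLinearMap, norm_permOp π⟩ φ χ

theorem inner_permOp_left {n : ℕ} (π : Equiv.Perm (Fin n)) (φ χ : TensorPower H n) :
    ⟪permOp π φ, χ⟫_ℂ = ⟪φ, permOp π⁻¹ χ⟫_ℂ := by
  rw [← inner_permOp π⁻¹, ← ContinuousLinearMap.comp_apply, permOp_comp, inv_mul_cancel,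
    permOp_one, ContinuousLinearMap.id_apply]

/-- The operator `|ψ⟩⟨ψ| ⊗ 1 ⊗ ⋯ ⊗ 1` on `H^{⊗(n+1)}`. -/
noncomputable def firstFactorProj (n : ℕ) (ψ : H) :
    TensorPower H (n + 1) →L[ℂ] TensorPower H (n + 1) :=
  tensorCons n ψ ∘L (tensorCons n ψ).adjoint

theorem adjoint_tensorCons_simpleTensor {n : ℕ} (ψ : H) (x : Fin (n + 1) → H) :
    (tensorCons n ψ).adjoint (simpleTensor x) = ⟪ψ, x 0⟫_ℂ • simpleTensor (Fin.tail x) := by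
  refine ext_inner_left ℂ fun φ => ?_
  rw [ContinuousLinearMap.adjoint_inner_right, inner_smul_right, ← inner_tensorCons,
    tensorCons_simpleTensor, Fin.cons_self_tail]

theorem firstFactorProj_simpleTensor {n : ℕ} (ψ : H) (x : Fin (n + 1) → H) :
    firstFactorProj n ψ (simpleTensor x) =
      ⟪ψ, x 0⟫_ℂ • simpleTensor (Function.update x 0 ψ) := by
  rw [firstFactorProj, ContinuousLinearMap.comp_apply, adjoint_tensorCons_simpleTensor, map_smul,
    tensorCons_simpleTensor]
  congr 2
  conv_rhs => rw [← Fin.cons_self_tail x, Fin.update_cons_zero]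

/-- When `π 0 ≠ 0`, the left factor contracts slot `π 0` of the original tensor with `ψ`, and the
right one slot `0`. Both slots are treated alike, so exchanging them beforehand changes nothing. -/
theorem firstFactorProj_permOp_firstFactorProj {n : ℕ} (ψ : H) (π : Equiv.Perm (Fin (n + 1)))
    (hπ : π 0 ≠ 0) :
    firstFactorProj n ψ ∘L permOp π⁻¹ ∘L firstFactorProj n ψ ∘L permOp (Equiv.swap 0 (π 0)) =
      firstFactorProj n ψ ∘L permOp π⁻¹ ∘L firstFactorProj n ψ := by
  refine ext_simpleTensor fun x => ?_
  simp only [ContinuousLinearMap.comp_apply, permOp_simpleTensor, firstFactorProj_simpleTensor,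
    map_smul, smul_smul, inv_inv, Equiv.swap_inv, Equiv.swap_apply_left, ne_eq, hπ,
    not_false_eq_true, Function.update_of_ne, Equiv.swap_apply_right]
  rw [mul_comm]
  congr 2
  funext k
  by_cases hk : k = 0
  · simp [hk]
  · rw [Function.update_of_ne hk, Function.update_of_ne hk]
    by_cases h0 : π k = 0
    · simp [h0]
    · rw [Function.update_of_ne h0, Function.update_of_ne h0,
        Equiv.swap_apply_of_ne_of_ne h0 (fun h => hk (π.injective h))]

/-- No two particles share the state `ψ`: the vector is unchanged when slots `0` and `π 0` of `χ`
are exchanged, while antisymmetry flips its sign. -/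
theorem firstFactorProj_permOp_firstFactorProj_eq_zero {n : ℕ} (ψ : H)
    {π : Equiv.Perm (Fin (n + 1))} (hπ : π 0 ≠ 0) {χ : TensorPower H (n + 1)}
    (hχ : χ ∈ antisymmetric H (n + 1)) :
    firstFactorProj n ψ (permOp π⁻¹ (firstFactorProj n ψ χ)) = 0 := by
  have h := DFunLike.congr_fun (firstFactorProj_permOp_firstFactorProj ψ π hπ) χ
  simp only [ContinuousLinearMap.comp_apply, hχ (Equiv.swap 0 (π 0)),
    Equiv.Perm.sign_swap hπ.symm] at h
  simp only [Units.val_neg, Units.val_one, Int.cast_neg, Int.cast_one, neg_smul, one_smul,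
    map_neg] at h
  have h2 := eq_neg_iff_add_eq_zero.1 h.symm
  rw [← two_smul ℂ] at h2
  exact (smul_eq_zero.1 h2).resolve_left two_ne_zero

theorem inner_firstFactorProj_left {n : ℕ} (ψ : H) (φ χ : TensorPower H (n + 1)) :
    ⟪firstFactorProj n ψ φ, χ⟫_ℂ = ⟪φ, firstFactorProj n ψ χ⟫_ℂ := by
  simp [firstFactorProj,
    ← ContinuousLinearMap.adjoint_inner_right]

/-- The Pauli principle: `a†(ψ) a(ψ) ≤ 1` on antisymmetric tensors. -/
theorem norm_sq_adjoint_tensorCons_le {n : ℕ} {ψ : H} (hψ : ‖ψ‖ = 1) {χ : TensorPower H (n + 1)}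
    (hχ : χ ∈ antisymmetric H (n + 1)) :
    (n + 1) * ‖(tensorCons n ψ).adjoint χ‖ ^ 2 ≤ ‖χ‖ ^ 2 := by
  set v := firstFactorProj n ψ χ with hv
  -- Up to sign, `w k` is `χ` with its `k`-th factor projected onto `ψ`. These `n + 1` vectors are
  -- pairwise orthogonal and of equal norm `a`, so Bessel applies after normalization.
  set w : Fin (n + 1) → TensorPower H (n + 1) := fun k => permOp (Equiv.swap 0 k) v with hw
  set a := ‖(tensorCons n ψ).adjoint χ‖ with ha
  have hva : ‖v‖ = a := by simp [hv, ha, firstFactorProj, norm_tensorCons, hψ]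
  have horth : ∀ k l, ⟪w k, w l⟫_ℂ = if k = l then ((a ^ 2 : ℝ) : ℂ) else 0 := by
    intro k l
    split_ifs with h
    · subst h
      rw [hw, inner_permOp, inner_self_eq_norm_sq_to_K, hva]; norm_cast
    -- The inner product is `⟨χ, F U_{π⁻¹} F χ⟩` with `F` the operator `firstFactorProj n ψ` and `π
    -- = (0 l)(0 k)`, which moves `0` exactly when `k ≠ l`.
    · have hπ : (Equiv.swap 0 l * Equiv.swap 0 k) 0 ≠ 0 := by
        rw [Equiv.Perm.mul_apply, Equiv.swap_apply_left]
        intro h'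
        rw [Equiv.swap_apply_eq_iff, Equiv.swap_apply_left] at h'
        exact h h'
      have := firstFactorProj_permOp_firstFactorProj_eq_zero ψ hπ hχ
      rw [mul_inv_rev, Equiv.swap_inv, Equiv.swap_inv, ← permOp_comp,
        ContinuousLinearMap.comp_apply] at this
      rw [hw, inner_permOp_left, Equiv.swap_inv, hv, inner_firstFactorProj_left, this,
        inner_zero_right]
  have hin : ∀ k, ‖⟪w k, χ⟫_ℂ‖ = a ^ 2 := by
    intro k
    -- The transposition acts on `χ` by a sign, leaving `⟨v, χ⟩ = a²`.
    rw [hw, inner_permOp_left, hχ, inner_smul_right, norm_mul, hv, firstFactorProj,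
      ContinuousLinearMap.comp_apply, ← ContinuousLinearMap.adjoint_inner_right,
      inner_self_eq_norm_sq_to_K, ← ha]
    generalize Equiv.Perm.sign (Equiv.swap 0 k)⁻¹ = s
    rcases Int.units_eq_one_or s with rfl | rfl <;> simp
  have ha0 : 0 ≤ a := norm_nonneg _
  rcases eq_or_lt_of_le ha0 with h0 | h0
  · rw [← h0]; simp
  have hon : Orthonormal ℂ fun k => ((a⁻¹ : ℝ) : ℂ) • w k := by
    rw [orthonormal_iff_ite]
    intro k l
    rw [inner_smul_left, inner_smul_right, horth]
    split_ifs
    · rw [Complex.conj_ofReal]; norm_cast; field_simp [h0.ne']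
    · simp
  -- Each of the `n + 1` Bessel terms is `(a⁻¹ a²)² = a²`.
  have hb := hon.sum_inner_products_le χ (s := Finset.univ)
  refine le_trans (le_of_eq ?_) hb
  simp only [inner_smul_left, norm_mul, hin, Complex.conj_ofReal, Complex.norm_real, norm_inv,
    Real.norm_of_nonneg ha0, Finset.sum_const, Finset.card_univ, Fintype.card_fin, nsmul_eq_mul]
  push_cast
  field_simp [h0.ne']

end TensorPower
-- Operator norm of positive operators
section PositiveNorm

variable {K : Type*} [NormedAddCommGroup K] [InnerProductSpace ℂ K] [CompleteSpace K]

/-- With `T = S²` and `‖S x‖² = ⟨x, T x⟩`, the quadratic form controls `‖S‖²`, which dominates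
`‖T‖`. -/
theorem norm_le_of_isPositive {T : K →L[ℂ] K} (hT : T.IsPositive) {r : ℝ} (hr : 0 ≤ r)
    (h : ∀ x, ‖x‖ = 1 → (⟪x, T x⟫_ℂ).re ≤ r) : ‖T‖ ≤ r := by
  obtain ⟨S, -, hSS, hST⟩ := exists_sqrt hT
  have hSr : ‖S‖ ≤ √r := by
    refine S.opNorm_le_of_unit_norm (Real.sqrt_nonneg r) fun x hx => ?_
    exact Real.le_sqrt_of_sq_le (hST x ▸ h x hx)
  rw [← hSS, ← Real.mul_self_sqrt hr]
  exact (S.opNorm_comp_le S).trans (by gcongr)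

theorem ofReal_norm_le_posTrace {T : K →L[ℂ] K} (hT : T.IsPositive) :
    ENNReal.ofReal ‖T‖ ≤ posTrace T := by
  rcases eq_or_ne (posTrace T) ∞ with h | h
  · simp [h]
  refine ENNReal.ofReal_le_of_le_toReal (norm_le_of_isPositive hT ENNReal.toReal_nonneg ?_)
  intro x hx
  have hon : Orthonormal ℂ fun _ : Unit => x := ⟨fun _ => hx, fun i j hij => (hij rfl).elim⟩
  rw [← ENNReal.ofReal_le_iff_le_toReal h]
  simpa using tsum_inner_le_posTrace hT hon

end PositiveNorm

/-! ### Convergence and norm of the partial trace -/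

section PartialTrace

variable {H : Type*} [NormedAddCommGroup H] [InnerProductSpace ℂ H] [CompleteSpace H]

omit [CompleteSpace H] in
theorem inner_extend {n : ℕ} (T : antisymmetric H n →L[ℂ] antisymmetric H n)
    (φ χ : TensorPower H n) :
    ⟪φ, extend T χ⟫_ℂ = ⟪(antisymmetric H n).orthogonalProjectionOnto φ,
      T ((antisymmetric H n).orthogonalProjectionOnto χ)⟫_ℂ := by
  rw [extend, ContinuousLinearMap.comp_apply, ← Submodule.adjoint_orthogonalProjectionOnto,
    ContinuousLinearMap.adjoint_inner_right, ContinuousLinearMap.comp_apply]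

omit [CompleteSpace H] in
theorem isPositive_extend {n : ℕ} {T : antisymmetric H n →L[ℂ] antisymmetric H n}
    (hT : T.IsPositive) : (extend T).IsPositive := by
  have h := hT.adjoint_conj (antisymmetric H n).orthogonalProjectionOnto
  rwa [Submodule.adjoint_orthogonalProjectionOnto] at h

variable {n : ℕ} {T : antisymmetric H (n + 1) →L[ℂ] antisymmetric H (n + 1)}

theorem isPositive_partialTraceTerm (hT : T.IsPositive) (φ : TensorPower H n) :
    (partialTraceTerm T φ).IsPositive :=
  (isPositive_extend hT).adjoint_conj _

omit [CompleteSpace H] in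
theorem orthonormal_tensorCons {ι κ : Type*} {e : ι → H} {f : κ → TensorPower H n}
    (he : Orthonormal ℂ e) (hf : Orthonormal ℂ f) :
    Orthonormal ℂ fun p : κ × ι => tensorCons n (e p.2) (f p.1) := by
  classical
  rw [orthonormal_iff_ite] at *
  rintro ⟨i, j⟩ ⟨k, l⟩
  simp only [inner_tensorCons, he, hf, Prod.mk.injEq]
  by_cases h1 : j = l <;> by_cases h2 : i = k <;> simp [h1, h2]

/-- The norm of each term is at most its trace, and the traces together sum the form of `extend T`
over the orthonormal family `e ⊗ f i`. -/
theorem tsum_norm_partialTraceTerm_le (hT : T.IsPositive) {ι : Type*} {f : ι → TensorPower H n}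
    (hf : Orthonormal ℂ f) :
    ∑' i, ENNReal.ofReal ‖partialTraceTerm T (f i)‖ ≤ posTrace T := by
  calc ∑' i, ENNReal.ofReal ‖partialTraceTerm T (f i)‖
      ≤ ∑' i, posTrace (partialTraceTerm T (f i)) :=
        ENNReal.tsum_le_tsum fun i => ofReal_norm_le_posTrace (isPositive_partialTraceTerm hT _)
    _ = ∑' p : ι × _, ENNReal.ofReal
          (⟪(antisymmetric H (n + 1)).orthogonalProjectionOnto
              (tensorCons n (stdBasis H p.2) (f p.1)),
            T ((antisymmetric H (n + 1)).orthogonalProjectionOnto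
              (tensorCons n (stdBasis H p.2) (f p.1)))⟫_ℂ).re := by
        rw [ENNReal.tsum_prod']
        simp only [posTrace, inner_partialTraceTerm, inner_extend]
    _ ≤ ENNReal.ofReal 1 * posTrace T :=
        tsum_inner_conj_le_posTrace hT _
          (norm_sq_adjoint_le (antisymmetric H (n + 1)).norm_orthogonalProjectionOnto_apply_le)
          (orthonormal_tensorCons (stdBasis H).orthonormal hf)
    _ = posTrace T := by simp

theorem summable_norm_partialTraceTerm (hT : T.IsPositive) (hT' : posTrace T ≠ ∞) {ι : Type*}
    {f : ι → TensorPower H n} (hf : Orthonormal ℂ f) :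
    Summable fun i => ‖partialTraceTerm T (f i)‖ := by
  have h := ENNReal.summable_toReal
    (ne_top_of_le_ne_top hT' (tsum_norm_partialTraceTerm_le hT hf))
  simpa only [ENNReal.toReal_ofReal (norm_nonneg _)] using h

/-- The factor `1 / (n + 1)` comes from the Pauli principle: the adjoint of `φ ↦ P (ψ ⊗ φ)` is the
adjoint of `φ ↦ ψ ⊗ φ` restricted to antisymmetric tensors. -/
theorem tsum_inner_partialTraceTerm_le (hT : T.IsPositive) {ψ : H} (hψ : ‖ψ‖ = 1) {ι : Type*}
    {f : ι → TensorPower H n} (hf : Orthonormal ℂ f) :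
    ∑' i, ENNReal.ofReal (⟪ψ, partialTraceTerm T (f i) ψ⟫_ℂ).re ≤
      ENNReal.ofReal (1 / (n + 1)) * posTrace T := by
  simp only [inner_partialTraceTerm, inner_extend]
  refine tsum_inner_conj_le_posTrace hT
    ((antisymmetric H (n + 1)).orthogonalProjectionOnto ∘L tensorCons n ψ) (fun χ => ?_) hf
  rw [ContinuousLinearMap.adjoint_comp, Submodule.adjoint_orthogonalProjectionOnto,
    div_mul_eq_mul_div, one_mul, le_div_iff₀' (by positivity)]
  exact norm_sq_adjoint_tensorCons_le hψ χ.2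

/-- Summability is not needed: a divergent sum has the default value `0`, which is positive. -/
theorem isPositive_partialTrace (hT : T.IsPositive) : (partialTrace T).IsPositive :=
  (ContinuousLinearMap.nonneg_iff_isPositive _).1 <| tsum_nonneg fun _ =>
    (ContinuousLinearMap.nonneg_iff_isPositive _).2 (isPositive_partialTraceTerm hT _)

theorem norm_partialTrace_le (hT : T.IsPositive) (hT' : posTrace T ≠ ∞) :
    ‖partialTrace T‖ ≤ 1 / (n + 1) * (posTrace T).toReal := by
  refine norm_le_of_isPositive (isPositive_partialTrace hT) (by positivity) fun ψ hψ => ?_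
  have hf := (stdBasis (TensorPower H n)).orthonormal
  have hs := (summable_norm_partialTraceTerm hT hT' hf).of_norm
  -- Norm convergence lets the continuous functional `S ↦ Re ⟨ψ, S ψ⟩` pass through the series.
  have hre := ((hs.hasSum.mapL (ContinuousLinearMap.apply ℂ H ψ)).mapL
    (innerSL ℂ ψ)).mapL Complex.reCLM
  have h := tsum_inner_partialTraceTerm_le hT hψ hf
  have hpos : ∀ i, 0 ≤ (⟪ψ, partialTraceTerm T (stdBasis (TensorPower H n) i) ψ⟫_ℂ).re :=
    fun i => (isPositive_partialTraceTerm hT _).re_inner_nonneg_right ψ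
  rw [← ENNReal.ofReal_tsum_of_nonneg hpos hre.summable] at h
  have h2 := (ENNReal.ofReal_le_iff_le_toReal (ENNReal.mul_ne_top ENNReal.ofReal_ne_top hT')).1 h
  rw [ENNReal.toReal_mul, ENNReal.toReal_ofReal (by positivity)] at h2
  exact hre.tsum_eq.symm.trans_le h2

end PartialTrace

/-! ### The particle-number blocks of an operator on Fock space -/

section Sector

variable {H : Type*} [NormedAddCommGroup H] [InnerProductSpace ℂ H]

theorem inner_sectorIncl {m : ℕ} (φ : antisymmetric H m) (χ : FockSpace H) :
    ⟪sectorIncl m φ, χ⟫_ℂ = ⟪φ, χ m⟫_ℂ := by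
  rw [sectorIncl, lp.singleContinuousLinearMap_apply]
  exact lp.inner_single_left (𝕜 := ℂ) (G := fun n => antisymmetric H n) m φ χ

theorem isPositive_sector {D : FockSpace H →L[ℂ] FockSpace H} (hD : D.IsPositive) (n : ℕ) :
    (sector D n).IsPositive :=
  hD.adjoint_conj _

theorem orthonormal_sectorIncl {ι : ℕ → Type*} {f : ∀ n, ι n → antisymmetric H n}
    (hf : ∀ n, Orthonormal ℂ (f n)) :
    Orthonormal ℂ fun p : Σ n, ι n => sectorIncl p.1 (f p.1 p.2) := by
  classical
  rw [orthonormal_iff_ite]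
  rintro ⟨m, i⟩ ⟨n, j⟩
  rw [inner_sectorIncl]
  by_cases h : m = n
  · subst h
    simp [sectorIncl, orthonormal_iff_ite.1 (hf m)]
  · simp [sectorIncl, h]

/-- Bases of the sectors together form an orthonormal family in Fock space, and orthonormality alone
suffices for an upper bound by the trace. -/
theorem tsum_posTrace_sector_le {D : FockSpace H →L[ℂ] FockSpace H} (hD : D.IsPositive) :
    ∑' n, posTrace (sector D n) ≤ posTrace D := by
  refine le_trans (le_of_eq ?_)
    (tsum_inner_le_posTrace hD
      (orthonormal_sectorIncl fun n => (stdBasis (antisymmetric H n)).orthonormal))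
  rw [ENNReal.tsum_sigma']
  simp only [posTrace, sector, ContinuousLinearMap.comp_apply,
    ContinuousLinearMap.adjoint_inner_right]

end Sector

end FermionFock

/-! ### Summation over the particle number -/

theorem mainTheorem5 {H : Type*} [NormedAddCommGroup H] [InnerProductSpace ℂ H] [CompleteSpace H]
    (D : FermionFock.FockSpace H →L[ℂ] FermionFock.FockSpace H)
    (hD : FermionFock.IsDensityOperator D)
    (hcomm : FermionFock.CommutesWithNumber D)
    (hN : FermionFock.FiniteExpectedNumber D) :
    (∀ n : ℕ, Summable fun i =>
      FermionFock.partialTraceTerm (FermionFock.sector D (n + 1))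
        (FermionFock.stdBasis (FermionFock.TensorPower H n) i)) ∧
    (Summable fun n : ℕ =>
      ((n : ℂ) + 1) • FermionFock.partialTrace (FermionFock.sector D (n + 1))) ∧
    ‖FermionFock.reducedNumberDensity D‖ ≤ 1 := by
  have hpos := FermionFock.isPositive_sector hD.1
  have htr : ∑' n, FermionFock.posTrace (FermionFock.sector D (n + 1)) ≤ 1 :=
    -- The shift by one drops the vacuum sector, which can only lower the sum.
    (ENNReal.tsum_comp_le_tsum_of_injective (add_left_injective 1) _).trans
      ((FermionFock.tsum_posTrace_sector_le hD.1).trans_eq hD.2)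
  have htop := ne_top_of_le_ne_top ENNReal.one_ne_top htr
  have hfin := ENNReal.ne_top_of_tsum_ne_top htop
  have hsum := ENNReal.summable_toReal htop
  have hnorm : ∀ n : ℕ,
      ‖((n : ℂ) + 1) • FermionFock.partialTrace (FermionFock.sector D (n + 1))‖ ≤
        (FermionFock.posTrace (FermionFock.sector D (n + 1))).toReal := by
    intro n
    have hn : ‖(n : ℂ) + 1‖ = n + 1 := by
      rw [← Nat.cast_succ, Complex.norm_natCast, Nat.cast_succ]
    have h := FermionFock.norm_partialTrace_le (hpos (n + 1)) (hfin n)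
    rwa [div_mul_eq_mul_div, one_mul, le_div_iff₀' (by positivity), ← hn, ← norm_smul] at h
  refine ⟨fun n => ?_, hsum.of_norm_bounded hnorm, ?_⟩
  · exact (FermionFock.summable_norm_partialTraceTerm (hpos (n + 1)) (hfin n)
      (FermionFock.stdBasis _).orthonormal).of_norm
  · refine (tsum_of_norm_bounded hsum.hasSum hnorm).trans ?_
    rw [← ENNReal.tsum_toReal_eq hfin]
    exact ENNReal.toReal_le_of_le_ofReal zero_le_one (by simpa using htr)
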